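/- Let $\lambda$ be an infinite cardinal and $\kappa=\lambda^{+}$. Let $L'_\kappa=\langle O,P_\alpha,p_\alpha:\alpha<\kappa\rangle$ be the language with unary predicates $O$, $P_\alpha$ and unary function symbols $p_\alpha$. Let $T'_\kappa$ be the universal $L'_\kappa$-theory saying that $O$ and the $P_\alpha$ are pairwise disjoint, that $p_\alpha(x)\in P_\alpha$ for all $x\in O$, and that $p_\alpha(x)=x$ for all $x\notin O$. For finite $w\subset\kappa$ let $L'_w=\langle O,P_\alpha,p_\alpha:\alpha\in w\rangle$, let $\mathbb K'_w$ be the class of finite $L'_w$-structures (the empty one included) satisfying those axioms of $T'_\kappa$ that are in $L'_w$, and let $T^\dagger_w$ be the complete $L'_w$-theory of the Fraïssé limit of $\mathbb K'_w$ (the unique countable ultrahomogeneous $L'_w$-structure with age $\mathbb K'_w$). Put $T^\dagger_\kappa=\bigcup_{w\subset\kappa\text{ finite}}T^\dagger_w$. Call an ultrafilter $\mathcal D$ on a set $I$ regular if there is a family $(X_\alpha)_{\alpha<|I|}$ of members of $\mathcal D$ such that $\{\alpha : t\in X_\alpha\}$ is finite for every $t\in I$. Call a structure $M$ $\mu$-saturated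 if for every $A\subseteq M$ with $|A|<\mu$, every complete $1$-type over $A$ (consistent with the theory of $M$ with constants for the elements of $A$) is realized in $M$. **Proposition.** Let $\mathcal D$ be a regular ultrafilter on $\lambda$, and let $M\models T^\dagger_\kappa$ be $\lambda^{++}$-saturated, where $\kappa=\lambda^{+}$. Then the ultrapower $M^\lambda/\mathcal D$ is $\lambda^{++}$-saturated. -/

import Mathlib

open scoped FirstOrder

universe u v v' w

namespace DaggerTheory

open FirstOrder FirstOrder.Language

/-- The function symbols of the language: one unary symbol `p α` for each index `α`. -/
inductive Func (ι : Type v) : ℕ → Type v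
  | p (α : ι) : Func ι 1

/-- The relation symbols of the language: a unary predicate `O` and, for each index `α`, a unary
predicate `P α`. -/
inductive Rel (ι : Type v) : ℕ → Type v
  | O : Rel ι 1
  | P (α : ι) : Rel ι 1

/-- The language `⟨O, P α, p α : α ∈ ι⟩`. -/
def lang (ι : Type v) : FirstOrder.Language.{v, v} := ⟨Func ι, Rel ι⟩

variable {ι : Type v}

/-- The predicate symbol `O`. -/
abbrev symO : (lang ι).Relations 1 := Rel.O

/-- The predicate symbol `P α`. -/
abbrev symP (α : ι) : (lang ι).Relations 1 := Rel.P α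

/-- The function symbol `p α`. -/
abbrev symp (α : ι) : (lang ι).Functions 1 := Func.p α

/-- Distinct predicates are disjoint: `∀ x, ¬ (Q x ∧ R x)`. -/
def axDisjoint (Q R : (lang ι).Relations 1) : (lang ι).Sentence :=
  ∀' ∼(Q.boundedFormula₁ &0 ⊓ R.boundedFormula₁ &0)

/-- `∀ x ∈ O, p α x ∈ P α`. -/
def axInto (α : ι) : (lang ι).Sentence :=
  ∀' (symO.boundedFormula₁ &0 ⟹ (symP α).boundedFormula₁ ((symp α).apply₁ &0))

/-- `∀ x ∉ O, p α x = x`. -/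
def axIdOff (α : ι) : (lang ι).Sentence :=
  ∀' (∼(symO.boundedFormula₁ &0) ⟹ ((symp α).apply₁ &0 =' &0))

variable (ι) in
/-- The universal theory `T'`: the predicates `O`, `P α` are pairwise disjoint, and each `p α` maps
`O` into `P α` and is the identity outside `O`. -/
def baseTheory : (lang ι).Theory :=
  {φ | ∃ Q R : (lang ι).Relations 1, Q ≠ R ∧ φ = axDisjoint Q R} ∪
    Set.range axInto ∪ Set.range axIdOff

variable (ι) in
/-- The class of finite models of `T'` (the empty structure is allowed). -/
def finiteModels : Set (CategoryTheory.Bundled.{v} (lang ι).Structure) :=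
  {A | Finite A ∧ A ⊨ baseTheory ι}

instance [Countable ι] : Countable (Σ n, (lang ι).Functions n) := by
  refine Function.Surjective.countable (f := fun α : ι => ⟨1, Func.p α⟩) ?_
  rintro ⟨_, ⟨α⟩⟩
  exact ⟨α, rfl⟩

/-- For a finite set `s` of indices, the complete theory `T†_s` of the Fraïssé limit of the class of
finite models of `T'` in the language `⟨O, P α, p α : α ∈ s⟩`. The Fraïssé limit exists
(`exists_isFraisseLimit` below) and is unique up to isomorphism
(`FirstOrder.Language.IsFraisseLimit.nonempty_equiv`); the theory is written as the set of sentences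
true in every Fraïssé limit, so that no representative has to be chosen. -/
def limitTheory (s : Finset ι) : (lang s).Theory :=
  {φ | ∀ (N : Type v) [(lang s).Structure N] [Countable N],
    IsFraisseLimit (finiteModels s) N → N ⊨ φ}

/-- The inclusion of the language `⟨O, P α, p α : α ∈ s⟩` into `⟨O, P α, p α : α ∈ ι⟩`. -/
def inclusion (s : Finset ι) : lang s →ᴸ lang ι where
  onFunction := fun _ f => match f with
    | .p α => Func.p (α : ι)
  onRelation := fun _ r => match r with
    | .O => Rel.O
    | .P α => Rel.P (α : ι)

variable (ι) in
/-- The theory `T†`: the union of the theories `T†_s` over all finite sets `s` of indices. -/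
def daggerTheory : (lang ι).Theory :=
  ⋃ s : Finset ι, (inclusion s).onTheory (limitTheory s)

/-- An ultrafilter on `I` is regular if there is a family `(X α)` of members of it, indexed by a set
of size `|I|`, such that every `t : I` lies in only finitely many `X α`. -/
def IsRegular {I : Type u} (D : Ultrafilter I) : Prop :=
  ∃ X : I → Set I, (∀ α, X α ∈ D) ∧ ∀ t : I, {α | t ∈ X α}.Finite

/-- An `L`-structure `M` is `μ`-saturated if for every `A ⊆ M` with `|A| < μ`, every complete
`1`-type over `A` (with respect to the theory of `M` with constants for the elements of `A`) is
realized by an element of `M`. -/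
def IsSaturated (L : FirstOrder.Language.{v, v'}) (μ : Cardinal.{u}) (M : Type w) [L.Structure M] : Prop :=
  ∀ A : Set M, Cardinal.lift.{u} (Cardinal.mk A) < Cardinal.lift.{w} μ →
    ∀ q : (L[[A]].completeTheory M).CompleteType (Fin 1),
      ∃ b : Fin 1 → M, ∀ φ ∈ q, (Formula.equivSentence.symm φ).Realize b

/-! ### Existence of the Fraïssé limits -/

theorem model_baseTheory_iff {A : Type w} [(lang ι).Structure A] :
    A ⊨ baseTheory ι ↔
      (∀ Q R : (lang ι).Relations 1, Q ≠ R → ∀ x : A,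
        ¬ (Structure.RelMap Q ![x] ∧ Structure.RelMap R ![x])) ∧
      (∀ α : ι, ∀ x : A, Structure.RelMap (symO (ι := ι)) ![x] →
        Structure.RelMap (symP α) ![Structure.funMap (symp α) ![x] ]) ∧
      (∀ α : ι, ∀ x : A, ¬ Structure.RelMap (symO (ι := ι)) ![x] →
        Structure.funMap (symp α) ![x] = x) := by
  have h1 : ∀ Q R : (lang ι).Relations 1, A ⊨ axDisjoint Q R ↔ ∀ x : A,
        ¬ (Structure.RelMap Q ![x] ∧ Structure.RelMap R ![x]) := by
    intro Q R
    simp [axDisjoint, Sentence.Realize, Formula.Realize, Fin.snoc, Term.realize,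
      BoundedFormula.realize_rel₁]
  have h2 : ∀ α : ι, A ⊨ axInto α ↔ ∀ x : A, Structure.RelMap (symO (ι := ι)) ![x] →
        Structure.RelMap (symP α) ![Structure.funMap (symp α) ![x] ] := by
    intro α
    simp [axInto, Sentence.Realize, Formula.Realize, Fin.snoc, Term.realize,
      BoundedFormula.realize_rel₁]
  have h3 : ∀ α : ι, A ⊨ axIdOff α ↔ ∀ x : A, ¬ Structure.RelMap (symO (ι := ι)) ![x] →
        Structure.funMap (symp α) ![x] = x := by
    intro α
    simp [axIdOff, Sentence.Realize, Formula.Realize, Fin.snoc, Term.realize,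
      BoundedFormula.realize_rel₁]
  rw [Theory.model_iff]
  constructor
  · intro h
    refine ⟨fun Q R hQR => (h1 Q R).1 (h _ (Or.inl (Or.inl ⟨Q, R, hQR, rfl⟩))),
      fun α => (h2 α).1 (h _ (Or.inl (Or.inr ⟨α, rfl⟩))), fun α => (h3 α).1 (h _ (Or.inr ⟨α, rfl⟩))⟩
  · rintro ⟨g1, g2, g3⟩ φ ((⟨Q, R, hQR, rfl⟩ | ⟨α, rfl⟩) | ⟨α, rfl⟩)
    · exact (h1 Q R).2 (g1 Q R hQR)
    · exact (h2 α).2 (g2 α)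
    · exact (h3 α).2 (g3 α)

variable (ι) in
/-- A concrete Fraïssé limit: infinitely many elements of `O` over each choice of values of the
`p α`, infinitely many elements in each `P α`, and infinitely many elements in no predicate. -/
abbrev Limit : Type v := ((ι → ℕ) × ℕ) ⊕ ((ι × ℕ) ⊕ ℕ)

instance limitStructure : (lang ι).Structure (Limit ι) where
  funMap := fun f x => match f, x with
    | .p α, x => match x 0 with
      | .inl a => .inr (.inl (α, a.1 α))
      | y => y
  RelMap := fun r x => match r, x with
    | .O, x => ∃ a, x 0 = Sum.inl a
    | .P α, x => ∃ n, x 0 = Sum.inr (Sum.inl (α, n))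

theorem relO_limit (x : Limit ι) :
    Structure.RelMap (symO (ι := ι)) ![x] ↔ ∃ a, x = Sum.inl a := Iff.rfl

theorem relP_limit (α : ι) (x : Limit ι) :
    Structure.RelMap (symP α) ![x] ↔ ∃ n, x = Sum.inr (Sum.inl (α, n)) := Iff.rfl

theorem funp_limit_inl (α : ι) (a : (ι → ℕ) × ℕ) :
    Structure.funMap (symp α) ![(Sum.inl a : Limit ι)] = Sum.inr (Sum.inl (α, a.1 α)) := rfl

theorem funp_limit_inr (α : ι) (a : (ι × ℕ) ⊕ ℕ) :
    Structure.funMap (symp α) ![(Sum.inr a : Limit ι)] = Sum.inr a := rfl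

theorem limit_model : Limit ι ⊨ baseTheory ι := by
  rw [model_baseTheory_iff]
  refine ⟨?_, ?_, ?_⟩
  · rintro (_ | α) (_ | β) hQR x ⟨⟨a, ha⟩, ⟨b, hb⟩⟩
    · exact hQR rfl
    · simp_all
    · simp_all
    · simp only [Matrix.cons_val_zero] at ha hb
      rw [ha] at hb
      simp only [Sum.inr.injEq, Sum.inl.injEq, Prod.mk.injEq] at hb
      exact hQR (by rw [hb.1])
  · rintro α x ⟨a, ha⟩
    rw [Matrix.cons_val_zero] at ha
    subst ha
    exact ⟨_, rfl⟩
  · intro α x hx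
    rcases x with a | a
    · exact absurd ⟨a, rfl⟩ hx
    · rfl

theorem vec_one {A : Type w} (x : Fin 1 → A) : x = ![x 0] := by
  ext i
  fin_cases i
  rfl

/-- A map between structures is an embedding when it is injective and respects the symbols. -/
def mkEmbedding {A B : Type*} [(lang ι).Structure A] [(lang ι).Structure B] (f : A → B)
    (hf : Function.Injective f)
    (hO : ∀ x, Structure.RelMap (symO (ι := ι)) ![f x] ↔ Structure.RelMap (symO (ι := ι)) ![x])
    (hP : ∀ α x, Structure.RelMap (symP (ι := ι) α) ![f x] ↔ Structure.RelMap (symP α) ![x])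
    (hp : ∀ α x, f (Structure.funMap (symp (ι := ι) α) ![x]) =
      Structure.funMap (symp α) ![f x]) : A ↪[lang ι] B where
  toFun := f
  inj' := hf
  map_fun' := by
    rintro _ ⟨α⟩ x
    rw [vec_one x, hp]
    congr 1
    ext i
    fin_cases i
    rfl
  map_rel' := by
    rintro _ (_ | α) x
    · rw [vec_one x, ← hO]
      apply iff_of_eq
      congr 1
      ext i
      fin_cases i
      rfl
    · rw [vec_one x, ← hP]
      apply iff_of_eq
      congr 1
      ext i
      fin_cases i
      rfl

theorem model_of_embedding {A B : Type*} [(lang ι).Structure A] [(lang ι).Structure B]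
    (f : A ↪[lang ι] B) (hB : B ⊨ baseTheory ι) : A ⊨ baseTheory ι := by
  rw [model_baseTheory_iff] at hB ⊢
  have hv : ∀ x : A, f ∘ ![x] = ![f x] := fun x => by
    ext i
    fin_cases i
    rfl
  have hr : ∀ (r : (lang ι).Relations 1) (x : A),
      Structure.RelMap r ![f x] ↔ Structure.RelMap r ![x] := fun r x => by
    rw [← hv, f.map_rel]
  have hfun : ∀ (g : (lang ι).Functions 1) (x : A),
      f (Structure.funMap g ![x]) = Structure.funMap g ![f x] := fun g x => by
    rw [f.map_fun, hv]
  obtain ⟨h1, h2, h3⟩ := hB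
  refine ⟨fun Q R hQR x hx => h1 Q R hQR (f x) (by rwa [hr, hr]), fun α x hx => ?_,
    fun α x hx => f.injective ?_⟩
  · rw [← hr, hfun]
    exact h2 α (f x) (by rwa [hr])
  · rw [hfun]
    exact h3 α (f x) (by rwa [hr])

theorem finite_of_fg [Finite ι] {A : Type*} [(lang ι).Structure A] (hA : A ⊨ baseTheory ι)
    (h : Structure.FG (lang ι) A) : Finite A := by
  obtain ⟨t, ht⟩ := h.out
  rw [model_baseTheory_iff] at hA
  obtain ⟨h1, h2, h3⟩ := hA
  let B : Set A := ↑t ∪ ⋃ α : ι, (fun x => Structure.funMap (symp α) ![x]) '' ↑t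
  have hB : B.Finite := t.finite_toSet.union (Set.finite_iUnion fun α => t.finite_toSet.image _)
  let S : (lang ι).Substructure A :=
    { carrier := B
      fun_mem := by
        rintro _ ⟨α⟩ x hx
        rw [vec_one x]
        rcases hx 0 with h | h
        · exact Or.inr (Set.mem_iUnion.2 ⟨α, x 0, h, rfl⟩)
        · obtain ⟨β, y, hy, hxy⟩ := Set.mem_iUnion.1 h
          have hx0 : ¬ Structure.RelMap (symO (ι := ι)) ![x 0] ∨ x 0 = y := by
            by_cases hyO : Structure.RelMap (symO (ι := ι)) ![y]
            · left
              intro hO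
              refine h1 symO (symP β) (by intro h; cases h) (x 0) ⟨hO, ?_⟩
              rw [← hxy]
              exact h2 β y hyO
            · right
              rw [← hxy]
              exact h3 β y hyO
          rcases hx0 with h0 | h0
          · have := h3 α (x 0) h0
            exact Set.mem_of_eq_of_mem this (hx 0)
          · rw [h0]
            exact Or.inr (Set.mem_iUnion.2 ⟨α, y, hy, rfl⟩) }
  have hS : S = ⊤ := by
    rw [eq_top_iff, ← ht, Substructure.closure_le]
    exact Set.subset_union_left
  have : (Set.univ : Set A) ⊆ B := fun x _ => by
    have hx : x ∈ S := by rw [hS]; trivial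
    exact hx
  exact Set.finite_univ_iff.1 (hB.subset this)

theorem exists_embedding_limit {A : Type*} [(lang ι).Structure A] [Finite A]
    (hA : A ⊨ baseTheory ι) : Nonempty (A ↪[lang ι] Limit ι) := by
  classical
  obtain ⟨e, he⟩ := Countable.exists_injective_nat A
  rw [model_baseTheory_iff] at hA
  obtain ⟨h1, h2, h3⟩ := hA
  have hOP : ∀ (α : ι) (x : A), Structure.RelMap (symP α) ![x] →
      ¬ Structure.RelMap (symO (ι := ι)) ![x] :=
    fun α x hP hO => h1 symO (symP α) (by intro h; cases h) x ⟨hO, hP⟩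
  have hPP : ∀ (α β : ι) (x : A), Structure.RelMap (symP α) ![x] →
      Structure.RelMap (symP β) ![x] → α = β := by
    intro α β x ha hb
    by_contra hne
    exact h1 (symP α) (symP β) (by intro h; cases h; exact hne rfl) x ⟨ha, hb⟩
  let f : A → Limit ι := fun x =>
    if Structure.RelMap (symO (ι := ι)) ![x] then
      .inl (fun α => e (Structure.funMap (symp α) ![x]), e x)
    else if h : ∃ α : ι, Structure.RelMap (symP α) ![x] then .inr (.inl (h.choose, e x))
    else .inr (.inr (e x))
  have fO : ∀ x, Structure.RelMap (symO (ι := ι)) ![x] →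
      f x = .inl (fun α => e (Structure.funMap (symp α) ![x]), e x) := fun x hx => by
    simp only [f, if_pos hx]
  have fP : ∀ α x, Structure.RelMap (symP (ι := ι) α) ![x] → f x = .inr (.inl (α, e x)) := by
    intro α x hx
    have hex : ∃ α : ι, Structure.RelMap (symP α) ![x] := ⟨α, hx⟩
    simp only [f, if_neg (hOP α x hx), dif_pos hex]
    rw [hPP _ _ x hex.choose_spec hx]
  have fR : ∀ x, ¬ Structure.RelMap (symO (ι := ι)) ![x] →
      (¬ ∃ α : ι, Structure.RelMap (symP α) ![x]) → f x = .inr (.inr (e x)) := by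
    intro x hx hx'
    simp only [f, if_neg hx, dif_neg hx']
  have cases3 : ∀ x : A, Structure.RelMap (symO (ι := ι)) ![x] ∨
      (∃ α : ι, Structure.RelMap (symP α) ![x]) ∨
      (¬ Structure.RelMap (symO (ι := ι)) ![x] ∧ ¬ ∃ α : ι, Structure.RelMap (symP α) ![x]) := by
    intro x
    tauto
  refine ⟨mkEmbedding f ?_ ?_ ?_ ?_⟩
  · intro x y hxy
    apply he
    rcases cases3 x with h | ⟨α, h⟩ | ⟨h, h'⟩ <;> rcases cases3 y with k | ⟨β, k⟩ | ⟨k, k'⟩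
    all_goals
      first | rw [fO x h] at hxy | rw [fP α x h] at hxy | rw [fR x h h'] at hxy
      first | rw [fO y k] at hxy | rw [fP β y k] at hxy | rw [fR y k k'] at hxy
      simp_all
  · intro x
    rw [relO_limit]
    rcases cases3 x with h | ⟨α, h⟩ | ⟨h, h'⟩
    · simp [fO x h, h]
    · simp [fP α x h, hOP α x h]
    · simp [fR x h h', h]
  · intro α x
    rw [relP_limit]
    rcases cases3 x with h | ⟨β, h⟩ | ⟨h, h'⟩
    · simpa [fO x h] using fun k => hOP α x k h
    · rw [fP β x h]
      constructor
      · rintro ⟨n, hn⟩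
        simp only [Sum.inr.injEq, Sum.inl.injEq, Prod.mk.injEq] at hn
        rwa [← hn.1]
      · intro k
        exact ⟨_, by rw [hPP _ _ x h k]⟩
    · simpa [fR x h h'] using fun k => h' ⟨α, k⟩
  · intro α x
    by_cases h : Structure.RelMap (symO (ι := ι)) ![x]
    · rw [fP α _ (h2 α x h), fO x h]
      rfl
    · rw [h3 α x h]
      rcases cases3 x with k | ⟨β, k⟩ | ⟨k, k'⟩
      · exact absurd k h
      · rw [fP β x k]; rfl
      · rw [fR x k k']; rfl

/-- An injection from a finite set of natural numbers extends to a permutation. -/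
theorem exists_perm_eqOn (s : Set ℕ) (hs : s.Finite) (f : ℕ → ℕ) (hf : Set.InjOn f s) :
    ∃ g : Equiv.Perm ℕ, ∀ n ∈ s, g n = f n := by
  classical
  have : Infinite ↥sᶜ := hs.infinite_compl.to_subtype
  have : Infinite ↥(f '' s)ᶜ := (hs.image f).infinite_compl.to_subtype
  obtain ⟨c⟩ : Nonempty (↥sᶜ ≃ ↥(f '' s)ᶜ) := nonempty_equiv_of_countable
  refine ⟨(Equiv.Set.sumCompl s).symm.trans
    ((Equiv.sumCongr (Equiv.Set.imageOfInjOn f s hf) c).trans (Equiv.Set.sumCompl (f '' s))), ?_⟩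
  intro n hn
  simp [Equiv.Set.sumCompl_symm_apply_of_mem hn, Equiv.Set.imageOfInjOn]

theorem limit_ultrahomogeneous [Finite ι] : (lang ι).IsUltrahomogeneous (Limit ι) := by
  classical
  intro S hS f
  have hfin : Finite S := finite_of_fg
    (model_of_embedding S.subtype limit_model) ((Substructure.fg_iff_structure_fg S).1 hS)
  have hSfin : (S : Set (Limit ι)).Finite := hfin
  let F : Limit ι → Limit ι := fun x => if h : x ∈ S then f ⟨x, h⟩ else x
  have hF : ∀ x (h : x ∈ S), f ⟨x, h⟩ = F x := fun x h => by simp only [F, dif_pos h]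
  have hFinj : ∀ x ∈ S, ∀ y ∈ S, F x = F y → x = y := by
    intro x hx y hy hxy
    rw [← hF x hx, ← hF y hy] at hxy
    simpa using f.injective hxy
  have hFO : ∀ a, (Sum.inl a : Limit ι) ∈ S → ∃ b, F (Sum.inl a) = Sum.inl b := by
    intro a ha
    have h := (f.map_rel (symO (ι := ι)) ![⟨_, ha⟩]).2 ⟨a, rfl⟩
    rw [← hF _ ha]
    exact h
  have hFP : ∀ α n, (Sum.inr (Sum.inl (α, n)) : Limit ι) ∈ S →
      ∃ m, F (Sum.inr (Sum.inl (α, n))) = Sum.inr (Sum.inl (α, m)) := by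
    intro α n ha
    have h := (f.map_rel (symP (ι := ι) α) ![⟨_, ha⟩]).2 ⟨n, rfl⟩
    rw [← hF _ ha]
    exact h
  have hFR : ∀ n, (Sum.inr (Sum.inr n) : Limit ι) ∈ S →
      ∃ m, F (Sum.inr (Sum.inr n)) = Sum.inr (Sum.inr m) := by
    intro n ha
    rw [← hF _ ha]
    rcases hx : f ⟨_, ha⟩ with b | ⟨α, b⟩ | b
    · obtain ⟨c, hc⟩ := (f.map_rel (symO (ι := ι)) ![⟨_, ha⟩]).1 ⟨b, hx⟩
      cases hc
    · obtain ⟨c, hc⟩ := (f.map_rel (symP (ι := ι) α) ![⟨_, ha⟩]).1 ⟨b, hx⟩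
      cases hc
    · exact ⟨b, rfl⟩
  have hFp : ∀ α a, (Sum.inl a : Limit ι) ∈ S →
      (Sum.inr (Sum.inl (α, a.1 α)) : Limit ι) ∈ S ∧ ∀ b, F (Sum.inl a) = Sum.inl b →
        F (Sum.inr (Sum.inl (α, a.1 α))) = Sum.inr (Sum.inl (α, b.1 α)) := by
    intro α a ha
    have hmem : (Sum.inr (Sum.inl (α, a.1 α)) : Limit ι) ∈ S :=
      S.fun_mem (symp α) ![Sum.inl a] (fun i => by fin_cases i; exact ha)
    refine ⟨hmem, fun b hb => ?_⟩
    have h := f.map_fun (symp (ι := ι) α) ![⟨_, ha⟩]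
    have e1 : Structure.funMap (symp (ι := ι) α) ![(⟨_, ha⟩ : S)] = ⟨_, hmem⟩ := rfl
    have e2 : f ∘ ![(⟨_, ha⟩ : S)] = ![Sum.inl b] := by
      ext i
      fin_cases i
      exact (hF _ ha).trans hb
    rw [e1, e2, hF] at h
    exact h
  have key : ∀ (i : ℕ → Limit ι), Function.Injective i → ∀ (p : Limit ι → ℕ),
      (∀ n, i n ∈ S → ∀ m, i m ∈ S → p (F (i n)) = p (F (i m)) → F (i n) = F (i m)) →
      ∃ g : Equiv.Perm ℕ, ∀ n, i n ∈ S → g n = p (F (i n)) := by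
    intro i hi p hp
    exact exists_perm_eqOn {n | i n ∈ S} (hSfin.preimage hi.injOn) (fun n => p (F (i n)))
      (fun n hn m hm h => hi (hFinj _ hn _ hm (hp n hn m hm h)))
  have hσ : ∀ α : ι, ∃ g : Equiv.Perm ℕ, ∀ n, (Sum.inr (Sum.inl (α, n)) : Limit ι) ∈ S →
      F (Sum.inr (Sum.inl (α, n))) = Sum.inr (Sum.inl (α, g n)) := by
    intro α
    obtain ⟨g, hg⟩ := key (fun n => Sum.inr (Sum.inl (α, n)))
      (fun n m h => by simpa using h)
      (fun x => match x with
        | .inr (.inl b) => b.2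
        | _ => 0) (by
        intro n hn m hm h
        obtain ⟨n', hn'⟩ := hFP α n hn
        obtain ⟨m', hm'⟩ := hFP α m hm
        simp only [hn', hm'] at h ⊢
        rw [h])
    refine ⟨g, fun n hn => ?_⟩
    obtain ⟨n', hn'⟩ := hFP α n hn
    rw [hg n hn]
    simp only [hn']
  choose σ hσ using hσ
  obtain ⟨ρ, hρ⟩ : ∃ g : Equiv.Perm ℕ, ∀ n, (Sum.inr (Sum.inr n) : Limit ι) ∈ S →
      F (Sum.inr (Sum.inr n)) = Sum.inr (Sum.inr (g n)) := by
    obtain ⟨g, hg⟩ := key (fun n => Sum.inr (Sum.inr n))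
      (fun n m h => by simpa using h)
      (fun x => match x with
        | .inr (.inr b) => b
        | _ => 0) (by
        intro n hn m hm h
        obtain ⟨n', hn'⟩ := hFR n hn
        obtain ⟨m', hm'⟩ := hFR m hm
        simp only [hn', hm'] at h ⊢
        rw [h])
    refine ⟨g, fun n hn => ?_⟩
    obtain ⟨n', hn'⟩ := hFR n hn
    rw [hg n hn]
    simp only [hn']
  have hb1 : ∀ a, (Sum.inl a : Limit ι) ∈ S → ∀ b, F (Sum.inl a) = Sum.inl b →
      b.1 = fun α => σ α (a.1 α) := by
    intro a ha b hb
    ext α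
    obtain ⟨h1, h2⟩ := hFp α a ha
    have h3 := h2 b hb
    rw [hσ α _ h1] at h3
    simpa using h3.symm
  have hτ : ∀ η : ι → ℕ, ∃ g : Equiv.Perm ℕ, ∀ n, (Sum.inl (η, n) : Limit ι) ∈ S →
      F (Sum.inl (η, n)) = Sum.inl (fun α => σ α (η α), g n) := by
    intro η
    obtain ⟨g, hg⟩ := key (fun n => Sum.inl (η, n))
      (fun n m h => by simpa using h)
      (fun x => match x with
        | .inl b => b.2
        | _ => 0) (by
        intro n hn m hm h
        obtain ⟨n', hn'⟩ := hFO _ hn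
        obtain ⟨m', hm'⟩ := hFO _ hm
        have e1 := hb1 _ hn _ hn'
        have e2 := hb1 _ hm _ hm'
        simp only [hn', hm'] at h ⊢
        rw [Prod.ext (e1.trans e2.symm) h])
    refine ⟨g, fun n hn => ?_⟩
    obtain ⟨n', hn'⟩ := hFO _ hn
    rw [hg n hn, ← hb1 _ hn _ hn']
    simp only [hn']
  choose τ hτ using hτ
  let G : Limit ι ≃ Limit ι := Equiv.sumCongr
    { toFun := fun a => (fun α => σ α (a.1 α), τ a.1 a.2)
      invFun := fun a => (fun α => (σ α).symm (a.1 α),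
        (τ (fun α => (σ α).symm (a.1 α))).symm a.2)
      left_inv := fun a => by simp
      right_inv := fun a => by simp }
    (Equiv.sumCongr
      { toFun := fun a => (a.1, σ a.1 a.2)
        invFun := fun a => (a.1, (σ a.1).symm a.2)
        left_inv := fun a => by simp
        right_inv := fun a => by simp } ρ)
  let E : Limit ι ↪[lang ι] Limit ι := mkEmbedding G G.injective
    (by
      rintro (a | a | a)
      · exact ⟨fun _ => ⟨_, rfl⟩, fun _ => ⟨_, rfl⟩⟩
      · exact ⟨(fun ⟨b, h⟩ => by cases h), (fun ⟨b, h⟩ => by cases h)⟩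
      · exact ⟨(fun ⟨b, h⟩ => by cases h), (fun ⟨b, h⟩ => by cases h)⟩)
    (by
      rintro α (a | ⟨β, a⟩ | a)
      · exact ⟨(fun ⟨b, h⟩ => by cases h), (fun ⟨b, h⟩ => by cases h)⟩
      · exact ⟨(fun ⟨b, h⟩ => by cases h; exact ⟨_, rfl⟩), (fun ⟨b, h⟩ => by cases h; exact ⟨_, rfl⟩)⟩
      · exact ⟨(fun ⟨b, h⟩ => by cases h), (fun ⟨b, h⟩ => by cases h)⟩)
    (by
      rintro α (a | a | a) <;> rfl)
  refine ⟨⟨G, E.map_fun', E.map_rel'⟩, ?_⟩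
  ext ⟨x, hx⟩
  change f ⟨x, hx⟩ = G x
  rw [hF]
  rcases x with ⟨η, n⟩ | ⟨α, n⟩ | n
  · exact hτ η n hx
  · exact hσ α n hx
  · exact hρ n hx

/-- The class of finite models of `T'` over finitely many indices has a Fraïssé limit. -/
theorem exists_isFraisseLimit (s : Finset ι) :
    ∃ (N : Type v) (_ : (lang s).Structure N) (_ : Countable N),
      IsFraisseLimit (finiteModels s) N := by
  refine ⟨Limit s, inferInstance, inferInstance, limit_ultrahomogeneous, ?_⟩
  ext A
  constructor
  · rintro ⟨hfg, ⟨f⟩⟩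
    have hA := model_of_embedding f limit_model
    exact ⟨finite_of_fg hA hfg, hA⟩
  · rintro ⟨hfin, hA⟩
    exact ⟨Structure.FG.of_finite, exists_embedding_limit hA⟩

end DaggerTheory

/-! Write κ for λ⁺⁺. For models of `daggerTheory`, κ-saturation is equivalent to an extension
property, `Rich`: outside every set of size below κ there are points of each P α, points in no
predicate, and points of O whose projections take any prescribed legal values, for all indices
simultaneously. This property passes to ultrapowers.

From saturation to richness (`rich_of_isSaturated`): a finite part of a requirement involves
finitely many indices and finitely many points to avoid, so it is a first-order sentence true in the
Fraïssé limit (`rich_finite`). There are only λ⁺ < κ indices, so one type over a small set can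
prescribe all projections.

Ultrapowers (`rich_ultrapower`): prescribed projections lift to functions that are legal at every
coordinate. Over each coordinate the fibre in M has at least κ points, and κ everywhere-distinct
choices give κ distinct classes, too many for a small set to contain.

From richness to saturation (`isSaturated_of_rich`): realize the type by a point x in another model
of the theory over A. One forth step extends the partial isomorphism between the term closures of A
to x, and the image of x realizes the type. Truth transfers by an Ehrenfeucht–Fraïssé argument
(`exists_boundedFormula_realize_iff`), because a formula sees only finitely many symbols and
parameters. -/

namespace DaggerTheory

open FirstOrder FirstOrder.Language Set

variable {ι : Type v}

/-! ### Partial isomorphisms and the forth step -/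

section PartialIso

variable {X Y : Type*} [(lang ι).Structure X] [(lang ι).Structure Y]

/-- `x` satisfies the predicate `O`. -/
abbrev IsO (ι : Type v) {X : Type*} [(lang ι).Structure X] (x : X) : Prop :=
  Structure.RelMap (symO (ι := ι)) ![x]

/-- `x` satisfies the predicate `P α`. -/
abbrev IsP (α : ι) {X : Type*} [(lang ι).Structure X] (x : X) : Prop :=
  Structure.RelMap (symP α) ![x]

/-- The function `p α`. -/
abbrev proj (α : ι) {X : Type*} [(lang ι).Structure X] (x : X) : X :=
  Structure.funMap (symp α) ![x]

theorem not_isO_of_isP (hX : X ⊨ baseTheory ι) {α : ι} {x : X} (h : IsP α x) : ¬ IsO ι x :=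
  fun hO => (model_baseTheory_iff.1 hX).1 symO (symP α) (by intro h; cases h) x ⟨hO, h⟩

theorem isP_unique (hX : X ⊨ baseTheory ι) {α β : ι} {x : X} (h : IsP α x) (h' : IsP β x) :
    α = β := by
  by_contra hne
  exact (model_baseTheory_iff.1 hX).1 (symP α) (symP β) (by intro h; cases h; exact hne rfl) x
    ⟨h, h'⟩

theorem isP_proj (hX : X ⊨ baseTheory ι) (α : ι) {x : X} (h : IsO ι x) : IsP α (proj α x) :=
  (model_baseTheory_iff.1 hX).2.1 α x h

theorem proj_of_not_isO (hX : X ⊨ baseTheory ι) (α : ι) {x : X} (h : ¬ IsO ι x) :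
    proj α x = x :=
  (model_baseTheory_iff.1 hX).2.2 α x h

theorem not_isO_proj (hX : X ⊨ baseTheory ι) (α : ι) (x : X) : ¬ IsO ι (proj α x) := by
  by_cases h : IsO ι x
  · exact not_isO_of_isP hX (isP_proj hX α h)
  · rwa [proj_of_not_isO hX α h]

/-- A set of pairs which is the graph of an isomorphism between two substructures, in the language
restricted to the indices in `s`. -/
structure PartialIso (s : Set ι) (G : Set (X × Y)) : Prop where
  eq_iff : ∀ p ∈ G, ∀ q ∈ G, p.1 = q.1 ↔ p.2 = q.2
  isO_iff : ∀ p ∈ G, IsO ι p.1 ↔ IsO ι p.2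
  isP_iff : ∀ α ∈ s, ∀ p ∈ G, IsP α p.1 ↔ IsP α p.2
  proj_mem : ∀ α ∈ s, ∀ p ∈ G, (proj α p.1, proj α p.2) ∈ G

theorem PartialIso.mono {s t : Set ι} {G : Set (X × Y)} (h : PartialIso t G) (hst : s ⊆ t) :
    PartialIso s G :=
  ⟨h.eq_iff, h.isO_iff, fun α hα => h.isP_iff α (hst hα), fun α hα => h.proj_mem α (hst hα)⟩

theorem PartialIso.swap {s : Set ι} {G : Set (X × Y)} (h : PartialIso s G) :
    PartialIso s (Prod.swap ⁻¹' G) where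
  eq_iff _ hp _ hq := (h.eq_iff _ hp _ hq).symm
  isO_iff _ hp := (h.isO_iff _ hp).symm
  isP_iff α hα _ hp := (h.isP_iff α hα _ hp).symm
  proj_mem α hα _ hp := h.proj_mem α hα _ hp

/-- The extension property of the Fraïssé limit, relative to a notion of small sets: outside each
small set there are elements of every kind. -/
structure Rich (s : Set ι) (small : Set Y → Prop) : Prop where
  exists_isP : ∀ α ∈ s, ∀ B, small B → ∃ y ∉ B, IsP α y
  exists_none : ∀ B, small B → ∃ y ∉ B, ¬ IsO ι y ∧ ∀ α ∈ s, ¬ IsP α y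
  exists_isO : ∀ B, small B → ∀ z : ι → Y, (∀ α ∈ s, IsP α (z α)) →
    ∃ y ∉ B, IsO ι y ∧ ∀ α ∈ s, proj α y = z α

/-- The pairs generated by the pair `(x, y)`. -/
def hull (s : Set ι) (x : X) (y : Y) : Set (X × Y) :=
  insert (x, y) ((fun α => (proj α x, proj α y)) '' s)

theorem mem_hull (s : Set ι) (x : X) (y : Y) : (x, y) ∈ hull s x y := mem_insert _ _

theorem hull_finite {s : Set ι} (hs : s.Finite) (x : X) (y : Y) : (hull s x y).Finite :=
  (hs.image _).insert _

theorem hull_subset {s : Set ι} {G : Set (X × Y)} (hG : PartialIso s G) {x : X} {y : Y}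
    (h : (x, y) ∈ G) : hull s x y ⊆ G := by
  rintro q (rfl | ⟨α, hα, rfl⟩)
  · exact h
  · exact hG.proj_mem α hα _ h

theorem proj_mem_hull (hX : X ⊨ baseTheory ι) (hY : Y ⊨ baseTheory ι) {s : Set ι} {x : X} {y : Y}
    {α : ι} (hα : α ∈ s) {q : X × Y} (hq : q ∈ hull s x y) :
    (proj α q.1, proj α q.2) ∈ hull s x y := by
  rcases hq with rfl | ⟨β, hβ, rfl⟩
  · exact Or.inr ⟨α, hα, rfl⟩
  · dsimp only
    rw [proj_of_not_isO hX _ (not_isO_proj hX β x), proj_of_not_isO hY _ (not_isO_proj hY β y)]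
    exact Or.inr ⟨β, hβ, rfl⟩

theorem hull_eq_singleton (hX : X ⊨ baseTheory ι) (hY : Y ⊨ baseTheory ι) (s : Set ι) {x : X}
    {y : Y} (hx : ¬ IsO ι x) (hy : ¬ IsO ι y) : hull s x y = {(x, y)} := by
  apply Subset.antisymm
  · rintro q (rfl | ⟨α, hα, rfl⟩)
    · rfl
    · simp only [proj_of_not_isO hX α hx, proj_of_not_isO hY α hy, mem_singleton_iff]
  · exact singleton_subset_iff.2 (mem_hull s x y)

theorem partialIso_union_singleton (hX : X ⊨ baseTheory ι) (hY : Y ⊨ baseTheory ι) {s : Set ι}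
    {G : Set (X × Y)} (hG : PartialIso s G) {x : X} {y : Y} (hx : ¬ IsO ι x) (hy : ¬ IsO ι y)
    (hP : ∀ α ∈ s, IsP α x ↔ IsP α y) (hxG : ∀ q ∈ G, q.1 ≠ x) (hyG : ∀ q ∈ G, q.2 ≠ y) :
    PartialIso s (G ∪ {(x, y)}) where
  eq_iff := by
    rintro p (hp | rfl) q (hq | rfl)
    · exact hG.eq_iff p hp q hq
    · exact iff_of_false (hxG p hp) (hyG p hp)
    · exact iff_of_false (hxG q hq).symm (hyG q hq).symm
    · exact iff_of_true rfl rfl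
  isO_iff := by
    rintro p (hp | rfl)
    · exact hG.isO_iff p hp
    · exact iff_of_false hx hy
  isP_iff := by
    rintro α hα p (hp | rfl)
    · exact hG.isP_iff α hα p hp
    · exact hP α hα
  proj_mem := by
    rintro α hα p (hp | rfl)
    · exact Or.inl (hG.proj_mem α hα p hp)
    · dsimp only
      rw [proj_of_not_isO hX α hx, proj_of_not_isO hY α hy]
      exact Or.inr rfl

/-- The projections of a point of O lie in distinct, disjoint P α, so they never collide with each
other. The only possible conflict is with `G`, and `hp` excludes it: each projected pair is either
already in `G` or new on both sides. -/
theorem partialIso_union_hull (hX : X ⊨ baseTheory ι) (hY : Y ⊨ baseTheory ι) {s : Set ι}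
    {G : Set (X × Y)} (hG : PartialIso s G) {x : X} {y : Y} (hx : IsO ι x) (hy : IsO ι y)
    (hxG : ∀ q ∈ G, q.1 ≠ x) (hyG : ∀ q ∈ G, q.2 ≠ y)
    (hp : ∀ α ∈ s, (proj α x, proj α y) ∈ G ∨
      ∀ q ∈ G, q.1 ≠ proj α x ∧ q.2 ≠ proj α y) :
    PartialIso s (G ∪ hull s x y) := by
  have hne : ∀ α, x ≠ proj α x ∧ y ≠ proj α y := fun α =>
    ⟨fun h => not_isO_proj hX α x (h ▸ hx), fun h => not_isO_proj hY α y (h ▸ hy)⟩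
  have hG' : ∀ p ∈ G, ∀ α ∈ s, p.1 = proj α x ↔ p.2 = proj α y := by
    intro p hpG α hα
    rcases hp α hα with h | h
    · exact hG.eq_iff p hpG _ h
    · exact iff_of_false (h p hpG).1 (h p hpG).2
  constructor
  · rintro p (hpG | rfl | ⟨α, hα, rfl⟩) q (hqG | rfl | ⟨β, hβ, rfl⟩)
    · exact hG.eq_iff p hpG q hqG
    · exact iff_of_false (hxG p hpG) (hyG p hpG)
    · exact hG' p hpG β hβ
    · exact iff_of_false (hxG q hqG).symm (hyG q hqG).symm
    · exact iff_of_true rfl rfl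
    · exact iff_of_false (hne β).1 (hne β).2
    · rw [eq_comm, hG' q hqG α hα, eq_comm]
    · exact iff_of_false (hne α).1.symm (hne α).2.symm
    · by_cases hαβ : α = β
      · subst hαβ
        exact iff_of_true rfl rfl
      · refine iff_of_false (fun h => hαβ ?_) (fun h => hαβ ?_)
        · exact isP_unique hX (isP_proj hX α hx) (mem_of_eq_of_mem (s := {a | IsP β a}) h
            (isP_proj hX β hx))
        · exact isP_unique hY (isP_proj hY α hy) (mem_of_eq_of_mem (s := {a | IsP β a}) h
            (isP_proj hY β hy))
  · rintro p (hpG | rfl | ⟨α, hα, rfl⟩)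
    · exact hG.isO_iff p hpG
    · exact iff_of_true hx hy
    · exact iff_of_false (not_isO_proj hX α x) (not_isO_proj hY α y)
  · rintro β hβ p (hpG | rfl | ⟨α, hα, rfl⟩)
    · exact hG.isP_iff β hβ p hpG
    · exact iff_of_false (fun h => not_isO_of_isP hX h hx) (fun h => not_isO_of_isP hY h hy)
    · by_cases hαβ : α = β
      · subst hαβ
        exact iff_of_true (isP_proj hX α hx) (isP_proj hY α hy)
      · exact iff_of_false (fun h => hαβ (isP_unique hX (isP_proj hX α hx) h))
          (fun h => hαβ (isP_unique hY (isP_proj hY α hy) h))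
  · rintro β hβ p (hpG | hpH)
    · exact Or.inl (hG.proj_mem β hβ p hpG)
    · exact Or.inr (proj_mem_hull hX hY hβ hpH)

/-- The forth step. For `x` in O the projections are matched first, keeping partners already fixed
by `G` and choosing fresh ones otherwise; richness then supplies a new point of O over them.
Distinct indices need no coordination. -/
theorem exists_partialIso_union_hull (hX : X ⊨ baseTheory ι) (hY : Y ⊨ baseTheory ι) {s : Set ι}
    {small : Set Y → Prop} (hR : Rich s small) {G : Set (X × Y)} (hG : PartialIso s G)
    (hsmall : small (Prod.snd '' G)) (x : X) : ∃ y, PartialIso s (G ∪ hull s x y) := by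
  by_cases hxG : ∃ y, (x, y) ∈ G
  · obtain ⟨y, hy⟩ := hxG
    exact ⟨y, by rwa [union_eq_self_of_subset_right (hull_subset hG hy)]⟩
  have hxG' : ∀ q ∈ G, q.1 ≠ x := by
    rintro q hq rfl
    exact hxG ⟨q.2, hq⟩
  have hran : ∀ y, y ∉ Prod.snd '' G → ∀ q ∈ G, q.2 ≠ y := by
    rintro y hy q hq rfl
    exact hy ⟨q, hq, rfl⟩
  by_cases hx : IsO ι x
  · have hz : ∀ α, ∃ z : Y, α ∈ s → IsP α z ∧ ((proj α x, z) ∈ G ∨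
        ∀ q ∈ G, q.1 ≠ proj α x ∧ q.2 ≠ z) := by
      intro α
      by_cases hα : α ∈ s
      · by_cases h : ∃ z, (proj α x, z) ∈ G
        · obtain ⟨z, hz⟩ := h
          exact ⟨z, fun _ => ⟨(hG.isP_iff α hα _ hz).1 (isP_proj hX α hx), Or.inl hz⟩⟩
        · obtain ⟨z, hz, hzP⟩ := hR.exists_isP α hα _ hsmall
          refine ⟨z, fun _ => ⟨hzP, Or.inr fun q hq => ⟨?_, hran z hz q hq⟩⟩⟩
          intro h'
          exact h ⟨q.2, h' ▸ hq⟩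
      -- An irrelevant value, needed only because `z` must be total.
      · obtain ⟨y, -, -⟩ := hR.exists_none _ hsmall
        exact ⟨y, fun h => absurd h hα⟩
    choose z hz using hz
    obtain ⟨y, hyG, hy, hyz⟩ := hR.exists_isO _ hsmall z fun α hα => (hz α hα).1
    refine ⟨y, partialIso_union_hull hX hY hG hx hy hxG' (hran y hyG) fun α hα => ?_⟩
    rw [hyz α hα]
    exact (hz α hα).2
  · suffices h : ∃ y ∉ Prod.snd '' G, ¬ IsO ι y ∧ ∀ α ∈ s, IsP α x ↔ IsP α y by
      obtain ⟨y, hyG, hy, hP⟩ := h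
      refine ⟨y, ?_⟩
      rw [hull_eq_singleton hX hY s hx hy]
      exact partialIso_union_singleton hX hY hG hx hy hP hxG' (hran y hyG)
    by_cases hP : ∃ α ∈ s, IsP α x
    · obtain ⟨α, hα, hxα⟩ := hP
      obtain ⟨y, hyG, hy⟩ := hR.exists_isP α hα _ hsmall
      refine ⟨y, hyG, not_isO_of_isP hY hy, fun β _ => ⟨fun h => ?_, fun h => ?_⟩⟩
      · rwa [← isP_unique hX hxα h]
      · rwa [← isP_unique hY hy h]
    · obtain ⟨y, hyG, hy, hyP⟩ := hR.exists_none _ hsmall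
      exact ⟨y, hyG, hy, fun α hα => iff_of_false (fun h => hP ⟨α, hα, h⟩) (hyP α hα)⟩

/-- Cuts a large partial isomorphism down to the part generated by `H`. With `s` and `H` finite the
result is finite, as the transfer of formulas requires. -/
theorem PartialIso.hulls (hX : X ⊨ baseTheory ι) (hY : Y ⊨ baseTheory ι) {s : Set ι}
    {G H : Set (X × Y)} (hG : PartialIso s G) (hH : H ⊆ G) :
    PartialIso s (⋃ q ∈ H, hull s q.1 q.2) := by
  have hsub : (⋃ q ∈ H, hull s q.1 q.2) ⊆ G :=
    iUnion₂_subset fun q hq => hull_subset hG (hH hq)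
  refine ⟨fun p hp q hq => hG.eq_iff p (hsub hp) q (hsub hq),
    fun p hp => hG.isO_iff p (hsub hp), fun α hα p hp => hG.isP_iff α hα p (hsub hp),
    fun α hα p hp => ?_⟩
  obtain ⟨q, hq, hpq⟩ := mem_iUnion₂.1 hp
  exact mem_iUnion₂.2 ⟨q, hq, proj_mem_hull hX hY hα hpq⟩

/-! ### Ehrenfeucht–Fraïssé transfer of formulas -/

theorem exists_term_realize_mem {γ : Type*} (t : (lang ι).Term γ) :
    ∃ (s : Finset ι) (S : Finset γ), ∀ G : Set (X × Y), PartialIso (s : Set ι) G → ∀ (v : γ → X) (w : γ → Y),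
      (∀ i ∈ S, (v i, w i) ∈ G) → (t.realize v, t.realize w) ∈ G := by
  classical
  induction t with
  | var i => exact ⟨∅, {i}, fun G _ v w h => h i (Finset.mem_singleton_self i)⟩
  | @func n f ts ih =>
    obtain ⟨α⟩ := f
    obtain ⟨s, S, h⟩ := ih 0
    refine ⟨insert α s, S, fun G hG v w hvw => ?_⟩
    have h1 := h G (hG.mono (by simp)) v w hvw
    have h2 := hG.proj_mem α (by simp) _ h1
    simp only [Term.realize]
    rw [vec_one (fun i => (ts i).realize v), vec_one (fun i => (ts i).realize w)]
    exact h2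

/-- Back-and-forth by induction on the formula. The finite set `s` of indices is fixed by the whole
formula in advance, so each quantifier adds only a finite hull and `G` stays finite; richness
against finite sets therefore suffices. -/
theorem exists_boundedFormula_realize_iff (hX : X ⊨ baseTheory ι) (hY : Y ⊨ baseTheory ι)
    (hRX : ∀ s : Finset ι, Rich (ι := ι) s (Set.Finite (α := X)))
    (hRY : ∀ s : Finset ι, Rich (ι := ι) s (Set.Finite (α := Y))) {γ : Type*} {n : ℕ}
    (φ : (lang ι).BoundedFormula γ n) :
    ∃ (s : Finset ι) (S : Finset γ), ∀ G : Set (X × Y), G.Finite → PartialIso (s : Set ι) G →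
      ∀ (v : γ → X) (w : γ → Y) (xs : Fin n → X) (ys : Fin n → Y),
      (∀ i ∈ S, (v i, w i) ∈ G) → (∀ j, (xs j, ys j) ∈ G) →
        (φ.Realize v xs ↔ φ.Realize w ys) := by
  classical
  have elim_mem : ∀ {n : ℕ} {G : Set (X × Y)} {S : Finset (γ ⊕ Fin n)} {S' : Finset γ}
      {v : γ → X} {w : γ → Y} {xs : Fin n → X} {ys : Fin n → Y}, S.toLeft ⊆ S' →
      (∀ i ∈ S', (v i, w i) ∈ G) → (∀ j, (xs j, ys j) ∈ G) →
      ∀ i ∈ S, (Sum.elim v xs i, Sum.elim w ys i) ∈ G := by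
    rintro n G S S' v w xs ys hS hv hxs (i | j) hi
    · exact hv i (hS (Finset.mem_toLeft.2 hi))
    · exact hxs j
  induction φ with
  | falsum => exact ⟨∅, ∅, fun _ _ _ _ _ _ _ _ _ => Iff.rfl⟩
  | equal t₁ t₂ =>
    obtain ⟨s₁, S₁, h₁⟩ := exists_term_realize_mem (X := X) (Y := Y) t₁
    obtain ⟨s₂, S₂, h₂⟩ := exists_term_realize_mem (X := X) (Y := Y) t₂
    refine ⟨s₁ ∪ s₂, S₁.toLeft ∪ S₂.toLeft, fun G _ hG v w xs ys hv hxs => ?_⟩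
    exact hG.eq_iff _
      (h₁ G (hG.mono (by simp)) _ _ (elim_mem Finset.subset_union_left hv hxs)) _
      (h₂ G (hG.mono (by simp)) _ _ (elim_mem Finset.subset_union_right hv hxs))
  | @rel n l R ts =>
    have key : ∀ r : Fin 1 → (lang ι).Term (γ ⊕ Fin n), ∀ Q : (lang ι).Relations 1,
        ∃ (s : Finset ι) (S : Finset γ), ∀ G : Set (X × Y), G.Finite → PartialIso (s : Set ι) G →
          ∀ (v : γ → X) (w : γ → Y) (xs : Fin n → X) (ys : Fin n → Y),
          (∀ i ∈ S, (v i, w i) ∈ G) → (∀ j, (xs j, ys j) ∈ G) →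
          (Structure.RelMap Q ![(r 0).realize (Sum.elim v xs)] ↔
            Structure.RelMap Q ![(r 0).realize (Sum.elim w ys)]) := by
      intro r Q
      obtain ⟨s, S, h⟩ := exists_term_realize_mem (X := X) (Y := Y) (r 0)
      rcases Q with _ | α
      · exact ⟨s, S.toLeft, fun G _ hG v w xs ys hv hxs =>
          hG.isO_iff _ (h G hG _ _ (elim_mem (Finset.Subset.refl _) hv hxs))⟩
      · exact ⟨insert α s, S.toLeft, fun G _ hG v w xs ys hv hxs =>
          hG.isP_iff α (by simp) _ (h G (hG.mono (by simp)) _ _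
            (elim_mem (Finset.Subset.refl _) hv hxs))⟩
    have hl : l = 1 := by cases R <;> rfl
    subst hl
    obtain ⟨s, S, h⟩ := key ts R
    refine ⟨s, S, fun G hfin hG v w xs ys hv hxs => ?_⟩
    have := h G hfin hG v w xs ys hv hxs
    simp only [BoundedFormula.Realize]
    rwa [vec_one (fun i => (ts i).realize (Sum.elim v xs)),
      vec_one (fun i => (ts i).realize (Sum.elim w ys))]
  | imp φ ψ ihφ ihψ =>
    obtain ⟨s₁, S₁, h₁⟩ := ihφ
    obtain ⟨s₂, S₂, h₂⟩ := ihψ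
    refine ⟨s₁ ∪ s₂, S₁ ∪ S₂, fun G hfin hG v w xs ys hv hxs => ?_⟩
    rw [BoundedFormula.realize_imp, BoundedFormula.realize_imp,
      h₁ G hfin (hG.mono (by simp)) v w xs ys (fun i hi => hv i (by simp [hi])) hxs,
      h₂ G hfin (hG.mono (by simp)) v w xs ys (fun i hi => hv i (by simp [hi])) hxs]
  | @all n φ ih =>
    obtain ⟨s, S, h⟩ := ih
    refine ⟨s, S, fun G hfin hG v w xs ys hv hxs => ?_⟩
    have step : ∀ x y, PartialIso (s : Set ι) (G ∪ hull (s : Set ι) x y) →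
        (φ.Realize v (Fin.snoc xs x) ↔ φ.Realize w (Fin.snoc ys y)) := by
      intro x y hxy
      refine h _ (hfin.union (hull_finite s.finite_toSet x y)) hxy v w _ _
        (fun i hi => Or.inl (hv i hi)) (fun j => ?_)
      refine Fin.lastCases ?_ (fun j => ?_) j
      · simpa using Or.inr (mem_hull _ x y)
      · simpa using Or.inl (hxs j)
    rw [BoundedFormula.realize_all, BoundedFormula.realize_all]
    constructor
    · intro hφ y
      -- The back step is the forth step for the inverse partial isomorphism.
      obtain ⟨x, hx⟩ := exists_partialIso_union_hull hY hX (hRX s) hG.swap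
        ((hfin.preimage Prod.swap_injective.injOn).image _) y
      refine (step x y ?_).1 (hφ x)
      convert hx.swap using 1
      ext ⟨a, b⟩
      simp [hull, and_comm]
    · intro hφ x
      obtain ⟨y, hy⟩ := exists_partialIso_union_hull hX hY (hRY s) hG (hfin.image _) x
      exact (step x y hy).2 (hφ y)

end PartialIso

/-! ### From the Fraïssé limits to models of T† -/

theorem isFraisseLimit_limit [Finite ι] : IsFraisseLimit (finiteModels ι) (Limit ι) := by
  refine ⟨limit_ultrahomogeneous, ?_⟩
  ext A
  constructor
  · rintro ⟨hfg, ⟨f⟩⟩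
    have hA := model_of_embedding f limit_model
    exact ⟨finite_of_fg hA hfg, hA⟩
  · rintro ⟨hfin, hA⟩
    exact ⟨Structure.FG.of_finite, exists_embedding_limit hA⟩

/-- By uniqueness of the Fraïssé limit, truth in the concrete model decides membership in the
theory. -/
theorem mem_limitTheory {s : Finset ι} {φ : (lang s).Sentence} (h : Limit s ⊨ φ) :
    φ ∈ limitTheory s := by
  intro N _ _ hN
  obtain ⟨e⟩ := isFraisseLimit_limit.nonempty_equiv hN
  exact (StrongHomClass.realize_sentence e φ).1 h

theorem reduct_realize {M : Type w} [(lang ι).Structure M] (hM : M ⊨ daggerTheory ι)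
    (s : Finset ι) {φ : (lang s).Sentence} (h : Limit s ⊨ φ) :
    @Sentence.Realize (lang s) M ((inclusion s).reduct M) φ := by
  let _ := (inclusion s).reduct M
  rw [← LHom.realize_onSentence M (inclusion s)]
  exact hM.realize_of_mem _ (mem_iUnion.2 ⟨s, φ, mem_limitTheory h, rfl⟩)

/-- Each axiom mentions at most two indices, so it already belongs to the language of a finite set
of indices. -/
theorem model_baseTheory_of_daggerTheory {M : Type w} [(lang ι).Structure M]
    (hM : M ⊨ daggerTheory ι) : M ⊨ baseTheory ι := by
  classical
  have key : ∀ s : Finset ι, @Theory.Model (lang s) M ((inclusion s).reduct M) (baseTheory s) := by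
    intro s
    let _ := (inclusion s).reduct M
    exact ⟨fun φ hφ => reduct_realize hM s (limit_model.realize_of_mem φ hφ)⟩
  have hO : ∀ (α : ι) (x : M), IsP α x → ¬ IsO ι x := fun α x h => by
    let _ := (inclusion {α}).reduct M
    exact not_isO_of_isP (key {α}) (α := ⟨α, Finset.mem_singleton_self α⟩) (x := x) h
  rw [model_baseTheory_iff]
  refine ⟨?_, fun α x => ?_, fun α x => ?_⟩
  · rintro (_ | α) (_ | β) hne x ⟨h, h'⟩
    · exact hne rfl
    · exact hO β x h' h
    · exact hO α x h h'
    · let _ := (inclusion {α, β}).reduct M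
      have := isP_unique (key {α, β}) (α := ⟨α, Finset.mem_insert_self α {β}⟩)
        (β := ⟨β, Finset.mem_insert_of_mem (Finset.mem_singleton_self β)⟩) (x := x) h h'
      rw [Subtype.mk.injEq] at this
      exact hne (by rw [this])
  · let _ := (inclusion {α}).reduct M
    exact isP_proj (key {α}) ⟨α, by simp⟩
  · let _ := (inclusion {α}).reduct M
    exact proj_of_not_isO (key {α}) ⟨α, by simp⟩

theorem rich_limit (s : Set ι) : Rich (Y := Limit ι) s Set.Finite where
  exists_isP α _ B hB := by
    have hinj : Function.Injective fun n : ℕ => (Sum.inr (Sum.inl (α, n)) : Limit ι) :=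
      fun n m h => by simpa using h
    obtain ⟨n, hn⟩ := (hB.preimage hinj.injOn).exists_notMem
    exact ⟨_, hn, n, rfl⟩
  exists_none B hB := by
    have hinj : Function.Injective fun n : ℕ => (Sum.inr (Sum.inr n) : Limit ι) :=
      fun n m h => by simpa using h
    obtain ⟨n, hn⟩ := (hB.preimage hinj.injOn).exists_notMem
    exact ⟨_, hn, (fun ⟨a, h⟩ => by cases h), (fun α _ ⟨a, h⟩ => by cases h)⟩
  exists_isO B hB z hz := by
    have hz' : ∀ α, ∃ n : ℕ, α ∈ s → z α = Sum.inr (Sum.inl (α, n)) := by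
      intro α
      by_cases hα : α ∈ s
      · obtain ⟨n, hn⟩ := hz α hα
        exact ⟨n, fun _ => hn⟩
      · exact ⟨0, fun h => absurd h hα⟩
    choose η hη using hz'
    have hinj : Function.Injective fun n : ℕ => (Sum.inl (η, n) : Limit ι) :=
      fun n m h => by simpa using h
    obtain ⟨n, hn⟩ := (hB.preimage hinj.injOn).exists_notMem
    exact ⟨_, hn, ⟨_, rfl⟩, fun α hα => (hη α hα).symm⟩

/-- The sentence `∀ x, θ x → ∃ y, ψ x y`. -/
noncomputable def forallExists {L : FirstOrder.Language.{v, v'}} {γ : Type w} [Finite γ]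
    (θ : L.Formula γ) (ψ : L.Formula (γ ⊕ Unit)) : L.Sentence :=
  Formula.iAlls γ ((θ.imp (Formula.iExs Unit ψ)).relabel Sum.inr)

theorem realize_forallExists {L : FirstOrder.Language.{v, v'}} {γ : Type w} [Finite γ]
    (θ : L.Formula γ) (ψ : L.Formula (γ ⊕ Unit)) (M : Type u) [L.Structure M] :
    M ⊨ forallExists θ ψ ↔
      ∀ x : γ → M, θ.Realize x → ∃ y, ψ.Realize (Sum.elim x fun _ => y) := by
  rw [Sentence.Realize, forallExists, Formula.realize_iAlls]
  refine forall_congr' fun x => ?_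
  rw [Formula.realize_relabel]
  change (θ.Realize x → (Formula.iExs Unit ψ).Realize x) ↔ _
  rw [Formula.realize_iExs]
  refine imp_congr Iff.rfl ⟨fun ⟨y, hy⟩ => ⟨y (), hy⟩, fun ⟨y, hy⟩ => ⟨fun _ => y, hy⟩⟩

/-- The formula saying that `y` differs from each variable `x b`. -/
noncomputable def notMemFormula (ι : Type v) {β γ : Type*} [Finite β] (x : β → γ) (y : γ) :
    (lang ι).Formula γ :=
  Formula.iInf fun b => ∼((Term.var y).equal (Term.var (x b)))

theorem realize_notMemFormula {M : Type w} [(lang ι).Structure M] {β γ : Type*} [Finite β]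
    (x : β → γ) (y : γ) (f : γ → M) :
    (notMemFormula ι x y).Realize f ↔ ∀ b, f y ≠ f (x b) := by
  simp [notMemFormula]

/-- For finite `s` and `B`, each clause of richness is an instance of a ∀∃ sentence. That sentence
holds in the concrete limit, where every kind of point occurs infinitely often. -/
theorem rich_finite {M : Type w} [(lang ι).Structure M] (hM : M ⊨ daggerTheory ι)
    (s : Finset ι) : Rich (Y := M) (s : Set ι) Set.Finite where
  exists_isP α hα B hB := by
    have : Finite B := hB
    -- `B` itself indexes the universal variables, so that the inclusion of `B` into `M` can later
    -- serve as the assignment.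
    let φ : (lang s).Sentence := forallExists (γ := B) ⊤
      (notMemFormula s Sum.inl (Sum.inr ()) ⊓
        (symP (ι := s) ⟨α, hα⟩).formula₁ (Term.var (Sum.inr ())))
    have h : Limit s ⊨ φ := by
      rw [realize_forallExists]
      intro x _
      obtain ⟨y, hy, hyP⟩ := (rich_limit univ).exists_isP ⟨α, hα⟩ trivial _ (finite_range x)
      refine ⟨y, Formula.realize_inf.2 ⟨(realize_notMemFormula _ _ _).2 fun b h => hy ⟨b, h.symm⟩,
        Formula.realize_rel₁.2 hyP⟩⟩
    let _ := (inclusion s).reduct M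
    obtain ⟨y, hy⟩ := (realize_forallExists _ _ _).1 (reduct_realize hM s h) (↑)
      (Formula.realize_top.2 trivial)
    obtain ⟨h1, h2⟩ := Formula.realize_inf.1 hy
    exact ⟨y, fun hyB => (realize_notMemFormula _ _ _).1 h1 ⟨y, hyB⟩ rfl, Formula.realize_rel₁.1 h2⟩
  exists_none B hB := by
    have : Finite B := hB
    let φ : (lang s).Sentence := forallExists (γ := B) ⊤
      (notMemFormula s Sum.inl (Sum.inr ()) ⊓
        (∼(symO.formula₁ (Term.var (Sum.inr ()))) ⊓
          Formula.iInf fun α : s => ∼((symP α).formula₁ (Term.var (Sum.inr ())))))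
    have h : Limit s ⊨ φ := by
      rw [realize_forallExists]
      intro x _
      obtain ⟨y, hy, hyO, hyP⟩ := (rich_limit (ι := s) univ).exists_none _ (finite_range x)
      refine ⟨y, Formula.realize_inf.2 ⟨(realize_notMemFormula _ _ _).2 fun b h => hy ⟨b, h.symm⟩,
        Formula.realize_inf.2 ⟨?_, Formula.realize_iInf.2 fun α => ?_⟩⟩⟩
      · rw [Formula.realize_not, Formula.realize_rel₁]
        exact hyO
      · rw [Formula.realize_not, Formula.realize_rel₁]
        exact hyP α trivial
    let _ := (inclusion s).reduct M
    obtain ⟨y, hy⟩ := (realize_forallExists _ _ _).1 (reduct_realize hM s h) (↑)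
      (Formula.realize_top.2 trivial)
    obtain ⟨h1, h2⟩ := Formula.realize_inf.1 hy
    obtain ⟨h2, h3⟩ := Formula.realize_inf.1 h2
    refine ⟨y, fun hyB => (realize_notMemFormula _ _ _).1 h1 ⟨y, hyB⟩ rfl, ?_, fun α hα => ?_⟩
    · rw [Formula.realize_not, Formula.realize_rel₁] at h2
      exact h2
    · have h4 := Formula.realize_iInf.1 h3 ⟨α, hα⟩
      rw [Formula.realize_not, Formula.realize_rel₁] at h4
      exact h4
  exists_isO B hB z hz := by
    have : Finite B := hB
    -- The variables from `B` are to be avoided; those from `s` are the prescribed projections.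
    let φ : (lang s).Sentence := forallExists (γ := B ⊕ s)
      (Formula.iInf fun α : s => (symP α).formula₁ (Term.var (Sum.inr α)))
      (notMemFormula s (fun b : B => Sum.inl (Sum.inl b)) (Sum.inr ()) ⊓
        (symO.formula₁ (Term.var (Sum.inr ())) ⊓
          Formula.iInf fun α : s => ((symp α).apply₁ (Term.var (Sum.inr ()))).equal
            (Term.var (Sum.inl (Sum.inr α)))))
    have h : Limit s ⊨ φ := by
      rw [realize_forallExists]
      intro x hx
      obtain ⟨y, hy, hyO, hyP⟩ := (rich_limit (ι := s) univ).exists_isO _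
        (finite_range (x ∘ Sum.inl)) (x ∘ Sum.inr)
        fun α _ => Formula.realize_rel₁.1 (Formula.realize_iInf.1 hx α)
      refine ⟨y, Formula.realize_inf.2 ⟨(realize_notMemFormula _ _ _).2 fun b h => hy ⟨b, h.symm⟩,
        Formula.realize_inf.2 ⟨Formula.realize_rel₁.2 hyO, Formula.realize_iInf.2 fun α => ?_⟩⟩⟩
      rw [Formula.realize_equal, Term.realize_functions_apply₁]
      exact hyP α trivial
    let _ := (inclusion s).reduct M
    obtain ⟨y, hy⟩ := (realize_forallExists _ _ _).1 (reduct_realize hM s h)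
      (Sum.elim (↑) fun α => z α)
      (Formula.realize_iInf.2 fun α => Formula.realize_rel₁.2 (hz α α.2))
    obtain ⟨h1, h2⟩ := Formula.realize_inf.1 hy
    obtain ⟨h2, h3⟩ := Formula.realize_inf.1 h2
    refine ⟨y, fun hyB => (realize_notMemFormula _ _ _).1 h1 ⟨y, hyB⟩ rfl,
      Formula.realize_rel₁.1 h2, fun α hα => ?_⟩
    have h4 := Formula.realize_iInf.1 h3 ⟨α, hα⟩
    rw [Formula.realize_equal, Term.realize_functions_apply₁] at h4
    exact h4

/-! ### Small sets, and richness from saturation -/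

/-- The set `B` has cardinality less than `κ`. -/
def IsSmall (κ : Cardinal.{u}) {Y : Type w} (B : Set Y) : Prop :=
  Cardinal.lift.{u} (Cardinal.mk B) < Cardinal.lift.{w} κ

theorem IsSmall.preimage {κ : Cardinal.{u}} {X : Type v} {Y : Type w} {B : Set Y}
    (hB : IsSmall κ B) {f : X → Y} (hf : Function.Injective f) : IsSmall κ (f ⁻¹' B) := by
  have h1 := Cardinal.lift_le.{u}.2 (Cardinal.mk_preimage_of_injective_lift f B hf)
  have h2 := Cardinal.lift_lt.{_, v}.2 hB
  rw [IsSmall, ← Cardinal.lift_lt.{_, w}]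
  simp only [Cardinal.lift_lift] at h1 h2 ⊢
  exact h1.trans_lt h2

theorem IsSmall.union {κ : Cardinal.{u}} (hκ : Cardinal.aleph0 ≤ κ) {Y : Type w} {A B : Set Y}
    (hA : IsSmall κ A) (hB : IsSmall κ B) : IsSmall κ (A ∪ B) := by
  refine (Cardinal.lift_le.2 (Cardinal.mk_union_le A B)).trans_lt ?_
  rw [Cardinal.lift_add]
  exact Cardinal.add_lt_of_lt (Cardinal.aleph0_le_lift.2 hκ) hA hB

theorem IsSmall.range {κ : Cardinal.{u}} {X : Type v} {Y : Type w}
    (hX : Cardinal.lift.{u} (Cardinal.mk X) < Cardinal.lift.{v} κ) (f : X → Y) :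
    IsSmall κ (Set.range f) := by
  have h1 := Cardinal.lift_le.{u}.2 (Cardinal.mk_range_le_lift (f := f))
  have h2 := Cardinal.lift_lt.{_, w}.2 hX
  rw [IsSmall, ← Cardinal.lift_lt.{_, v}]
  simp only [Cardinal.lift_lift] at h1 h2 ⊢
  exact h1.trans_lt h2

/-- Replaces complete types by finitely satisfiable families of formulas: by compactness such a
family is consistent with the theory over `A`, hence contained in a complete type. -/
theorem IsSaturated.exists_realize {L : FirstOrder.Language.{v, v'}} {κ : Cardinal.{u}}
    {M : Type w} [L.Structure M] (hM : IsSaturated L κ M) {A : Set M} (hA : IsSmall κ A)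
    {K : Type*} (Φ : K → L.Formula (A ⊕ Fin 1))
    (hΦ : ∀ F : Finset K, ∃ b : M, ∀ k ∈ F, (Φ k).Realize (Sum.elim (↑) fun _ => b)) :
    ∃ b : M, ∀ k, (Φ k).Realize (Sum.elim (↑) fun _ => b) := by
  classical
  obtain ⟨b₀, -⟩ := hΦ ∅
  have : Nonempty M := ⟨b₀⟩
  let ψ : K → L[[A]].Formula (Fin 1) := fun k => BoundedFormula.constantsVarsEquiv.symm (Φ k)
  have hψ : ∀ (k : K) (b : Fin 1 → M), (ψ k).Realize b ↔ (Φ k).Realize (Sum.elim (↑) b) := by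
    intro k b
    have := BoundedFormula.realize_constantsVarsEquiv (M := M) (φ := ψ k) (v := b) (xs := default)
    rw [Equiv.apply_symm_apply] at this
    exact this.symm
  let S : L[[A]][[Fin 1]].Theory := Set.range fun k => Formula.equivSentence (ψ k)
  have hsat : ((L[[A]].lhomWithConstants (Fin 1)).onTheory (L[[A]].completeTheory M) ∪
      S).IsSatisfiable := by
    rw [Theory.isSatisfiable_iff_isFinitelySatisfiable]
    intro T₀ hT₀
    have hsub : ((T₀.filter (· ∈ S) : Finset _) : Set L[[A]][[Fin 1]].Sentence) ⊆
        (fun k => Formula.equivSentence (ψ k)) '' univ := by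
      intro φ hφ
      rw [image_univ]
      exact (Finset.mem_filter.1 hφ).2
    obtain ⟨F, -, hF⟩ := Finset.subset_set_image_iff.1 hsub
    obtain ⟨b, hb⟩ := hΦ F
    let _ : (constantsOn (Fin 1)).Structure M := constantsOn.structure fun _ => b
    have hT : M ⊨ (L[[A]].lhomWithConstants (Fin 1)).onTheory (L[[A]].completeTheory M) :=
      (LHom.onTheory_model _ _).2 inferInstance
    have : M ⊨ (T₀ : L[[A]][[Fin 1]].Theory) := by
      refine ⟨fun φ hφ => ?_⟩
      rcases hT₀ hφ with h | h
      · exact hT.realize_of_mem φ h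
      · have : φ ∈ F.image fun k => Formula.equivSentence (ψ k) := by
          rw [hF]
          exact Finset.mem_filter.2 ⟨hφ, h⟩
        obtain ⟨k, hk, rfl⟩ := Finset.mem_image.1 this
        rw [Formula.realize_equivSentence]
        exact (hψ k _).2 (hb k hk)
    exact Theory.Model.isSatisfiable M
  have hne : {p : (L[[A]].completeTheory M).CompleteType (Fin 1) | S ⊆ ↑p}.Nonempty := by
    rw [nonempty_iff_ne_empty, Ne, Theory.CompleteType.setOfPred_subset_eq_empty_iff, not_not]
    exact hsat
  obtain ⟨q, hq⟩ := hne
  obtain ⟨b, hb⟩ := hM A hA q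
  refine ⟨b 0, fun k => ?_⟩
  have h := hb _ (hq ⟨k, rfl⟩)
  rw [Equiv.symm_apply_apply, hψ] at h
  convert h using 2
  ext i
  rw [Subsingleton.elim i 0]

/-- The conditions y ≠ a for a in `A` are added to the family. A finite part forbids only finitely
many points, whence the finite `B` in `hf`. -/
theorem IsSaturated.exists_notMem_realize {L : FirstOrder.Language.{v, v'}} {κ : Cardinal.{u}}
    {M : Type w} [L.Structure M] (hM : IsSaturated L κ M) {A : Set M} (hA : IsSmall κ A)
    {J : Type*} (φ : L.Formula (A ⊕ Fin 1)) (f : J → L.Formula (A ⊕ Fin 1))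
    (hf : ∀ (F : Finset J) (B : Set M), B.Finite → ∃ b ∉ B,
      φ.Realize (Sum.elim (↑) fun _ => b) ∧ ∀ j ∈ F, (f j).Realize (Sum.elim (↑) fun _ => b)) :
    ∃ b ∉ A, φ.Realize (Sum.elim (↑) fun _ => b) ∧
      ∀ j, (f j).Realize (Sum.elim (↑) fun _ => b) := by
  classical
  let Φ : Unit ⊕ (J ⊕ A) → L.Formula (A ⊕ Fin 1) := Sum.elim (fun _ => φ)
    (Sum.elim f fun a => ∼((Term.var (Sum.inr 0)).equal (Term.var (Sum.inl a))))
  obtain ⟨b, hb⟩ := hM.exists_realize hA Φ (by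
    intro F
    obtain ⟨b, hb, h1, h2⟩ := hf F.toRight.toLeft ((↑) '' (F.toRight.toRight : Set A))
      ((Finset.finite_toSet _).image _)
    refine ⟨b, ?_⟩
    rintro (_ | j | a) hk
    · exact h1
    · exact h2 j (by simpa using hk)
    · simp only [Φ, Sum.elim_inr, Formula.realize_not, Formula.realize_equal, Term.realize_var,
        Sum.elim_inl]
      rintro rfl
      exact hb ⟨a, by simpa using hk, rfl⟩)
  refine ⟨b, fun hbA => ?_, hb (Sum.inl ()), fun j => hb (Sum.inr (Sum.inl j))⟩
  have := hb (Sum.inr (Sum.inr ⟨b, hbA⟩))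
  simp [Φ] at this

theorem rich_of_isSaturated {κ : Cardinal.{u}} (hκ : Cardinal.aleph0 ≤ κ)
    (hικ : Cardinal.lift.{u} (Cardinal.mk ι) < Cardinal.lift.{v} κ) {M : Type w}
    [(lang ι).Structure M] (hM : M ⊨ daggerTheory ι) (hsat : IsSaturated (lang ι) κ M) :
    Rich (Y := M) (univ : Set ι) (IsSmall κ) where
  exists_isP α _ B hB := by
    obtain ⟨b, hb, h, -⟩ := hsat.exists_notMem_realize hB
      ((symP α).formula₁ (Term.var (Sum.inr 0))) (fun _ : Empty => ⊤) (by
        intro F B' hB'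
        obtain ⟨b, hb, h⟩ := (rich_finite hM {α}).exists_isP α (by simp) B' hB'
        exact ⟨b, hb, Formula.realize_rel₁.2 h, fun j => j.elim⟩)
    exact ⟨b, hb, Formula.realize_rel₁.1 h⟩
  exists_none B hB := by
    obtain ⟨b, hb, h, h'⟩ := hsat.exists_notMem_realize hB
      (∼(symO.formula₁ (Term.var (Sum.inr 0))))
      (fun α : ι => ∼((symP α).formula₁ (Term.var (Sum.inr 0)))) (by
        intro F B' hB'
        obtain ⟨b, hb, h, h'⟩ := (rich_finite hM F).exists_none B' hB'
        simp only [Formula.realize_not, Formula.realize_rel₁]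
        exact ⟨b, hb, h, h'⟩)
    simp only [Formula.realize_not, Formula.realize_rel₁] at h h'
    exact ⟨b, hb, h, fun α _ => h' α⟩
  exists_isO B hB z hz := by
    -- The prescribed values `z α` serve as parameters; adding them keeps the set small because
    -- there are fewer than `κ` indices.
    obtain ⟨b, hb, h, h'⟩ := hsat.exists_notMem_realize (hB.union hκ (IsSmall.range hικ z))
      (symO.formula₁ (Term.var (Sum.inr 0)))
      (fun α : ι => ((symp α).apply₁ (Term.var (Sum.inr 0))).equal
        (Term.var (Sum.inl ⟨z α, Or.inr ⟨α, rfl⟩⟩))) (by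
        intro F B' hB'
        obtain ⟨b, hb, h, h'⟩ := (rich_finite hM F).exists_isO B' hB' z fun α _ => hz α trivial
        simp only [Formula.realize_equal, Formula.realize_rel₁, Term.realize_functions_apply₁]
        exact ⟨b, hb, h, h'⟩)
    simp only [Formula.realize_equal, Formula.realize_rel₁, Term.realize_functions_apply₁] at h h'
    exact ⟨b, fun h => hb (Or.inl h), h, fun α _ => h' α⟩

/-! ### Richness passes to ultrapowers -/

section Ultrapower

variable {I : Type u} {M : Type w} (D : Ultrafilter I)

/-- The class of a function in the ultrapower. -/
def toUltrapower (x : I → M) : (D : Filter I).Product fun _ => M :=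
  Quotient.mk (Filter.productSetoid (D : Filter I) fun _ => M) x

theorem toUltrapower_surjective : Function.Surjective (toUltrapower (M := M) D) :=
  fun y => Quotient.inductionOn y fun x => ⟨x, rfl⟩

theorem toUltrapower_eq_iff (x y : I → M) :
    toUltrapower D x = toUltrapower D y ↔ ∀ᶠ t in (D : Filter I), x t = y t :=
  Quotient.eq (r := Filter.productSetoid (D : Filter I) fun _ => M)

theorem toUltrapower_const_injective :
    Function.Injective fun b : M => toUltrapower D fun _ => b := by
  intro b c h
  obtain ⟨t, ht⟩ := ((toUltrapower_eq_iff D _ _).1 h).exists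
  exact ht

variable [(lang ι).Structure M]

theorem relMap_toUltrapower (R : (lang ι).Relations 1) (x : I → M) :
    Structure.RelMap R ![toUltrapower D x] ↔
      ∀ᶠ t in (D : Filter I), Structure.RelMap R ![x t] := by
  have h := relMap_quotient_mk' (L := lang ι) (s := (D : Filter I).productSetoid fun _ => M)
    R ![x]
  rw [vec_one (fun i => _)] at h
  refine h.trans (Filter.eventually_congr (Filter.Eventually.of_forall fun t => ?_))
  rw [vec_one (fun i => _)]
  rfl

theorem proj_toUltrapower (α : ι) (x : I → M) :
    proj α (toUltrapower D x) = toUltrapower D fun t => proj α (x t) := by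
  have h := Ultraproduct.term_realize_cast (u := D) (M := fun _ => M) (fun _ : Unit => x)
    ((symp α).apply₁ (Term.var ()))
  simp only [Term.realize_functions_apply₁, Term.realize_var] at h
  exact h

/-- Diagonal points suffice for the first two clauses. The clause for O is solved coordinatewise,
with enough solutions to escape any small set. -/
theorem rich_ultrapower {κ : Cardinal.{u}} (hR : Rich (Y := M) (univ : Set ι) (IsSmall κ)) :
    Rich (Y := (D : Filter I).Product fun _ => M) (univ : Set ι) (IsSmall κ) where
  exists_isP α _ B hB := by
    obtain ⟨b, hb, h⟩ := hR.exists_isP α trivial _ (hB.preimage (toUltrapower_const_injective D))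
    exact ⟨_, hb, (relMap_toUltrapower D _ _).2 (Filter.Eventually.of_forall fun _ => h)⟩
  exists_none B hB := by
    obtain ⟨b, hb, h, h'⟩ := hR.exists_none _ (hB.preimage (toUltrapower_const_injective D))
    refine ⟨_, hb, fun hO => ?_, fun α _ hP => ?_⟩
    · exact h ((relMap_toUltrapower D _ _).1 hO).exists.choose_spec
    · exact h' α trivial ((relMap_toUltrapower D _ _).1 hP).exists.choose_spec
  exists_isO B hB z hz := by
    -- A representative is corrected off a set in `D` so that it lies in P α at every coordinate.
    -- All indices are then legal at every `t`, and no intersection of large sets over all α is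
    -- needed.
    have hlift : ∀ α, ∃ x : I → M, toUltrapower D x = z α ∧ ∀ t, IsP α (x t) := by
      classical
      intro α
      obtain ⟨x, hx⟩ := toUltrapower_surjective D (z α)
      obtain ⟨b, -, hb⟩ := hR.exists_isP α trivial _
        (hB.preimage (toUltrapower_const_injective D))
      have hP : ∀ᶠ t in (D : Filter I), IsP α (x t) :=
        (relMap_toUltrapower D _ _).1 (hx ▸ hz α trivial)
      refine ⟨fun t => if IsP α (x t) then x t else b, ?_, fun t => ?_⟩
      · rw [← hx, toUltrapower_eq_iff]
        filter_upwards [hP] with t ht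
        rw [if_pos ht]
      · by_cases h : IsP α (x t)
        · simpa only [if_pos h] using h
        · simpa only [if_neg h] using hb
    choose x hxz hxP using hlift
    let S : I → Set M := fun t => {y | IsO ι y ∧ ∀ α, proj α y = x α t}
    -- A fibre of size below `κ` could itself be taken as the set to avoid, and richness of `M`
    -- would give a point of the fibre outside it.
    have hS : ∀ t, Nonempty (κ.out ↪ S t) := by
      intro t
      rw [← Cardinal.lift_mk_le', Cardinal.mk_out]
      by_contra hlt
      obtain ⟨y, hyS, hyO, hy⟩ := hR.exists_isO (S t) (not_le.1 hlt) (fun α => x α t)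
        fun α _ => hxP α t
      exact hyS ⟨hyO, fun α => hy α trivial⟩
    let e : ∀ t, κ.out ↪ S t := fun t => (hS t).some
    let g : κ.out → (D : Filter I).Product fun _ => M := fun k => toUltrapower D fun t => e t k
    have hg : Function.Injective g := by
      intro k l h
      obtain ⟨t, ht⟩ := ((toUltrapower_eq_iff D _ _).1 h).exists
      exact (e t).injective (Subtype.ext ht)
    -- Otherwise `g` would inject a set of size `κ` into the small set `B`.
    have hk : ∃ k, g k ∉ B := by
      by_contra! hall
      have h := hB.preimage hg
      rw [show g ⁻¹' B = univ from eq_univ_of_forall hall] at h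
      simp [IsSmall] at h
    obtain ⟨k, hk⟩ := hk
    refine ⟨g k, hk, (relMap_toUltrapower D _ _).2 (Filter.Eventually.of_forall fun t =>
      (e t k).2.1), fun α _ => ?_⟩
    rw [proj_toUltrapower, ← hxz]
    congr 1
    ext t
    exact (e t k).2.2 α

end Ultrapower

/-! ### Saturation from richness -/

theorem realize_iff_of_model_completeTheory {L : FirstOrder.Language.{v, v'}} {N X : Type*}
    [L.Structure N] [L.Structure X] (h : X ⊨ L.completeTheory N) (φ : L.Sentence) :
    X ⊨ φ ↔ N ⊨ φ := by
  refine ⟨fun hX => ?_, fun hN => h.realize_of_mem φ hN⟩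
  by_contra hN
  exact h.realize_of_mem φ.not hN hX

theorem partialIso_terms {γ : Type*} {X Y : Type*} [(lang ι).Structure X] [(lang ι).Structure Y]
    (v : γ → X) (w : γ → Y) (h : ∀ φ : (lang ι).Formula γ, φ.Realize v ↔ φ.Realize w) (s : Set ι) :
    PartialIso s (Set.range fun t : (lang ι).Term γ => (t.realize v, t.realize w)) where
  eq_iff := by
    rintro _ ⟨t, rfl⟩ _ ⟨t', rfl⟩
    simpa only [Formula.realize_equal] using h (t.equal t')
  isO_iff := by
    rintro _ ⟨t, rfl⟩
    simpa only [Formula.realize_rel₁] using h (symO.formula₁ t)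
  isP_iff := by
    rintro α _ _ ⟨t, rfl⟩
    simpa only [Formula.realize_rel₁] using h ((symP α).formula₁ t)
  proj_mem := by
    rintro α _ _ ⟨t, rfl⟩
    exact ⟨(symp α).apply₁ t, by simp only [Term.realize_functions_apply₁]⟩

/-- Terms have depth at most one in effect: a projected point is outside O, so every further
projection fixes it. Hence there are at most |A| + |ι|·|A| values. -/
theorem isSmall_range_terms {κ : Cardinal.{u}} (hκ : Cardinal.aleph0 ≤ κ)
    (hικ : Cardinal.lift.{u} (Cardinal.mk ι) < Cardinal.lift.{v} κ) {N : Type w}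
    [(lang ι).Structure N] (hN : N ⊨ baseTheory ι) {A : Set N} (hA : IsSmall κ A) :
    IsSmall κ (Set.range fun t : (lang ι).Term A => t.realize (M := N) (↑)) := by
  have hsub : (Set.range fun t : (lang ι).Term A => t.realize (M := N) (↑)) ⊆
      A ∪ Set.range fun p : ι × A => proj p.1 (p.2 : N) := by
    rintro _ ⟨t, rfl⟩
    induction t with
    | var a => exact Or.inl a.2
    | @func n f ts ih =>
      obtain ⟨α⟩ := f
      simp only [Term.realize]
      rw [vec_one (fun i => (ts i).realize (M := N) (↑))]
      rcases ih 0 with h | ⟨⟨β, a⟩, h⟩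
      · exact Or.inr ⟨⟨α, ⟨_, h⟩⟩, rfl⟩
      · refine Or.inr ⟨⟨β, a⟩, ?_⟩
        dsimp only at h ⊢
        rw [← h]
        exact (proj_of_not_isO hN α (not_isO_proj hN β _)).symm
  refine (Cardinal.lift_le.2 (Cardinal.mk_le_mk_of_subset hsub)).trans_lt
    (hA.union hκ (IsSmall.range ?_ _))
  have h1 := Cardinal.lift_lt.{_, w}.2 hικ
  have h2 := Cardinal.lift_lt.{_, v}.2 hA
  simp only [Cardinal.lift_lift] at h1 h2
  rw [Cardinal.mk_prod, Cardinal.lift_mul]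
  simp only [Cardinal.lift_lift]
  exact Cardinal.mul_lt_of_lt (Cardinal.aleph0_le_lift.2 hκ) h1 h2

theorem isSaturated_of_rich {κ : Cardinal.{u}} (hκ : Cardinal.aleph0 ≤ κ)
    (hικ : Cardinal.lift.{u} (Cardinal.mk ι) < Cardinal.lift.{v} κ) {N : Type w}
    [(lang ι).Structure N] (hN : N ⊨ daggerTheory ι)
    (hR : Rich (Y := N) (univ : Set ι) (IsSmall κ)) : IsSaturated (lang ι) κ N := by
  classical
  intro A hA q
  -- `X` is only elementarily equivalent to `N` over `A`; no embedding is needed, since the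
  -- comparison runs through the term closures of the constants.
  obtain ⟨X, v, hv⟩ := Theory.exists_modelType_is_realized_in _ q
  let _ : (lang ι).Structure X := ((lang ι).lhomWithConstants A).reduct X
  have hXN := realize_iff_of_model_completeTheory (N := N) X.is_model
  let j : A → X := fun a => ((lang ι).con a : X)
  have hj : ∀ φ : (lang ι).Formula A, φ.Realize j ↔ φ.Realize (M := N) (↑) := by
    intro φ
    have h1 := Formula.realize_equivSentence X φ
    have h2 := Formula.realize_equivSentence N φ
    exact h1.symm.trans ((hXN _).trans h2)
  have hX : X ⊨ daggerTheory ι := by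
    refine ⟨fun φ hφ => ?_⟩
    rw [← LHom.realize_onSentence X ((lang ι).lhomWithConstants A), hXN,
      LHom.realize_onSentence]
    exact hN.realize_of_mem φ hφ
  have hXb := model_baseTheory_of_daggerTheory hX
  have hNb := model_baseTheory_of_daggerTheory hN
  have hG := partialIso_terms j (fun a : A => (a : N)) hj univ
  obtain ⟨b, hb⟩ := exists_partialIso_union_hull hXb hNb hR hG (by
    rw [← range_comp]
    exact isSmall_range_terms hκ hικ hNb hA) (v 0)
  refine ⟨fun _ => b, fun ψ hψ => ?_⟩
  rw [← hv, Theory.CompleteType.mem_typeOf] at hψ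
  let φ := BoundedFormula.constantsVarsEquiv (Formula.equivSentence.symm ψ)
  obtain ⟨s, S, h⟩ := exists_boundedFormula_realize_iff hXb hNb (rich_finite hX) (rich_finite hN) φ
  let H : Set (X × N) :=
    (fun i => (Sum.elim j v i, Sum.elim (fun a : A => (a : N)) (fun _ => b) i)) '' S
  have hH : H ⊆ (Set.range fun t : (lang ι).Term A => (t.realize j, t.realize (M := N) (↑))) ∪
      hull (univ : Set ι) (v 0) b := by
    rintro _ ⟨a | i, -, rfl⟩
    · exact Or.inl ⟨Term.var a, rfl⟩
    · rw [Subsingleton.elim i 0]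
      exact Or.inr (mem_hull _ _ _)
  have hfin : (⋃ q ∈ H, hull (s : Set ι) q.1 q.2).Finite :=
    (S.finite_toSet.image _).biUnion fun q _ => hull_finite s.finite_toSet _ _
  have key := h _ hfin ((hb.mono (subset_univ _)).hulls hXb hNb hH) (Sum.elim j v)
    (Sum.elim (fun a : A => (a : N)) (fun _ => b)) default default
    (fun i hi => mem_iUnion₂.2 ⟨_, ⟨i, hi, rfl⟩, mem_hull _ _ _⟩) (fun i => i.elim0)
  have h1 := BoundedFormula.realize_constantsVarsEquiv (M := X)
    (φ := Formula.equivSentence.symm ψ) (v := v) (xs := default)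
  have h2 := BoundedFormula.realize_constantsVarsEquiv (M := N)
    (φ := Formula.equivSentence.symm ψ) (v := fun _ => b) (xs := default)
  exact h2.1 (key.1 (h1.2 hψ))

end DaggerTheory

theorem mainTheorem7 {I : Type u} {ι : Type v} {M : Type w} [(DaggerTheory.lang ι).Structure M]
    (hI : Cardinal.aleph0 ≤ Cardinal.mk I)
    (D : Ultrafilter I) (hD : DaggerTheory.IsRegular D)
    (hι : Cardinal.lift.{u} (Cardinal.mk ι) = Order.succ (Cardinal.lift.{v} (Cardinal.mk I)))
    (hM : M ⊨ DaggerTheory.daggerTheory ι)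
    (hsat : DaggerTheory.IsSaturated (DaggerTheory.lang ι)
      (Order.succ (Order.succ (Cardinal.mk I))) M) :
    DaggerTheory.IsSaturated (DaggerTheory.lang ι) (Order.succ (Order.succ (Cardinal.mk I)))
      ((D : Filter I).Product fun _ => M) := by
  have hκ : Cardinal.aleph0 ≤ Order.succ (Order.succ (Cardinal.mk I)) :=
    hI.trans ((Order.le_succ _).trans (Order.le_succ _))
  have hικ : Cardinal.lift.{u} (Cardinal.mk ι) <
      Cardinal.lift.{v} (Order.succ (Order.succ (Cardinal.mk I))) := by
    rw [hι, ← Cardinal.lift_succ, Cardinal.lift_lt]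
    exact Order.lt_succ _
  have hR := DaggerTheory.rich_of_isSaturated hκ hικ hM hsat
  -- Łoś's theorem needs `M` nonempty, which richness provides.
  obtain ⟨b, -⟩ := hR.exists_none ∅ (by simp [DaggerTheory.IsSmall])
  have : Nonempty M := ⟨b⟩
  refine DaggerTheory.isSaturated_of_rich hκ hικ ⟨fun φ hφ => ?_⟩ (DaggerTheory.rich_ultrapower D hR)
  rw [FirstOrder.Language.Ultraproduct.sentence_realize]
  exact Filter.Eventually.of_forall fun _ => hM.realize_of_mem φ hφ
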